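/- Let $G$ be a finitely generated group and $d\ge 1$. Let $\mathcal S=M_d(\mathbb C)$, and let $\mathcal S^{\otimes G}$ be the quasi-local (UHF) $C^*$-algebra, i.e. the norm closure of the union of its canonical subalgebras $\mathcal S_\Lambda\simeq \mathcal S^{\otimes\Lambda}\simeq\mathbb B((\mathbb C^d)^{\otimes\Lambda})$, with $\Lambda$ ranging over the finite subsets of $G$. A family of projections $p_\Lambda\in\mathcal S_\Lambda$, indexed by the finite subsets $\Lambda\subset G$, is a frustration-free system if $p_{\Lambda_1}p_{\Lambda_2}=p_{\Lambda_2}p_{\Lambda_1}=p_{\Lambda_1}$ whenever $\Lambda_1\subseteq\Lambda_2$, and it is proper if $p_\Lambda<1$ for all $\Lambda$. A frustration-free ground state of $\{p_\Lambda\}$ is a state $\omega$ of $\mathcal S^{\otimes G}$ with $\omega(p_\Lambda)=0$ for all $\Lambda$. A $C^*$-subalgebra $\mathcal B\subseteq \mathcal S^{\otimes G}$ is hereditary if $0\le a\le b$ with $b\in\mathcal B$ implies $a\in\mathcal B$. For a frustration-free proper system put $$\mathfrak p^{-1}(\{p_\Lambda\})=\overline{w\,\mathcal S^{\otimes G}\,w},\qquad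 w=\sum_{m\ge1}2^{-m}p_{\Lambda_m},$$ where $\Lambda_1\subseteq\Lambda_2\subseteq\cdots$ are finite sets with $\bigcup_m\Lambda_m=G$. Let $\{p_\Lambda\}$ be a frustration-free proper system and write $p_\Lambda^\perp=1-p_\Lambda$. Assume that for every finite $\Delta\subset G$ and every $a\in\mathcal S_\Delta$ $$\lim_{\Lambda\supseteq\Delta}\bigl\|p_\Lambda^\perp a\,p_\Lambda^\perp-\omega_\Lambda(a)\,p_\Lambda^\perp\bigr\|=0,\qquad \omega_\Lambda(a)=\frac{\mathrm{Tr}(a\,p_\Lambda^\perp)}{\dim p_\Lambda^\perp},$$ where the limit is along the net of finite subsets ordered by inclusion, $\mathrm{Tr}$ is the matrix trace of $\mathcal S_\Lambda$ and $\dim p_\Lambda^\perp$ is the rank of $p_\Lambda^\perp$ in $\mathcal S_\Lambda$. Then $\{p_\Lambda\}$ has exactly one frustration-free ground state, and, for every choice of $\{\Lambda_m\}$, $\mathfrak p^{-1}(\{p_\Lambda\})$ is a maximal element of the set of proper hereditary $C^*$-subalgebras of $\mathcal S^{\otimes G}$, ordered by inclusion. -/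

import Mathlib

open Filter Topology
open scoped ComplexOrder

noncomputable section

namespace FrustrationFree

/-! ### The quasi-local algebra

The sites are the elements of `G`, the site algebra is `M_d(ℂ)`.  The algebra is realised in its
faithful representation on `ℓ²` of the set of all spin configurations (the regular representation
of the groupoid of the relation "equal outside a finite set"). -/

/-- Spin configurations on `G`. -/
abbrev Config (G : Type*) (d : ℕ) : Type _ := G → Fin d

/-- The observables `S_Λ = ⨂_{g ∈ Λ} M_d(ℂ)`, as matrices indexed by spin configurations on `Λ`. -/
abbrev LocalMatrix {G : Type*} (d : ℕ) (Λ : Finset G) : Type _ :=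
  Matrix (Λ → Fin d) (Λ → Fin d) ℂ

/-- The Hilbert space `ℓ²` over the set of spin configurations. -/
abbrev ConfigSpace (G : Type*) (d : ℕ) : Type _ := lp (fun _ : Config G d => ℂ) 2

section Embedding

variable {G : Type*} [DecidableEq G] {d : ℕ}

/-- The configuration equal to `k` on `Λ` and to `j` off `Λ`. -/
def overwrite (Λ : Finset G) (j : Config G d) (k : Λ → Fin d) : Config G d :=
  fun g => if h : g ∈ Λ then k ⟨g, h⟩ else j g

@[simp] lemma restrict_overwrite (Λ : Finset G) (j : Config G d) (k : Λ → Fin d) :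
    Λ.restrict (overwrite Λ j k) = k := by
  funext g; simp [overwrite]

@[simp] lemma overwrite_overwrite (Λ : Finset G) (j : Config G d) (k l : Λ → Fin d) :
    overwrite Λ (overwrite Λ j k) l = overwrite Λ j l := by
  funext g; by_cases h : g ∈ Λ <;> simp [overwrite, h]

@[simp] lemma overwrite_restrict (Λ : Finset G) (j : Config G d) :
    overwrite Λ j (Λ.restrict j) = j := by
  funext g; by_cases h : g ∈ Λ <;> simp [overwrite, h]

lemma overwrite_of_restrict_eq {Λ : Finset G} {j : Config G d} {l : Λ → Fin d}
    (h : Λ.restrict j = l) : overwrite Λ j l = j := by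
  subst h; simp

/-- The coordinates of the vector `e_{l k} ξ`, where `e_{l k} ∈ S_Λ` is a matrix unit. -/
def unitFun (Λ : Finset G) (l k : Λ → Fin d) (ξ : Config G d → ℂ) : Config G d → ℂ :=
  fun j => if Λ.restrict j = l then ξ (overwrite Λ j k) else 0

lemma sum_unitFun_le (Λ : Finset G) (l k : Λ → Fin d) (ξ : ConfigSpace G d)
    (s : Finset (Config G d)) :
    ∑ j ∈ s, ‖unitFun Λ l k ξ j‖ ^ (2 : ENNReal).toReal ≤ ‖ξ‖ ^ (2 : ENNReal).toReal := by
  classical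
  have hinj : Set.InjOn (fun j => overwrite Λ j k)
      (s.filter fun j => Λ.restrict j = l : Finset (Config G d)) := by
    intro i hi j hj hij
    simp only [Finset.coe_filter, Set.mem_ofPred_eq] at hi hj
    have h := congrArg (fun c => overwrite Λ c l) hij
    simpa [overwrite_of_restrict_eq hi.2, overwrite_of_restrict_eq hj.2] using h
  calc ∑ j ∈ s, ‖unitFun Λ l k ξ j‖ ^ (2 : ENNReal).toReal
      = ∑ j ∈ s.filter (fun j => Λ.restrict j = l),
          ‖ξ (overwrite Λ j k)‖ ^ (2 : ENNReal).toReal := by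
        rw [Finset.sum_filter]
        refine Finset.sum_congr rfl fun j _ => ?_
        by_cases h : Λ.restrict j = l <;> simp [unitFun, h]
    _ = ∑ i ∈ (s.filter fun j => Λ.restrict j = l).image (fun j => overwrite Λ j k),
          ‖ξ i‖ ^ (2 : ENNReal).toReal := by
        rw [Finset.sum_image hinj]
    _ ≤ ‖ξ‖ ^ (2 : ENNReal).toReal := lp.sum_rpow_le_norm_rpow (by norm_num) ξ _

/-- The matrix unit `e_{l k} ∈ S_Λ` acting on the configuration space. -/
def matrixUnit (Λ : Finset G) (l k : Λ → Fin d) : ConfigSpace G d →L[ℂ] ConfigSpace G d :=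
  LinearMap.mkContinuous
    { toFun := fun ξ => ⟨unitFun Λ l k ξ, memℓp_gen' (sum_unitFun_le Λ l k ξ)⟩
      map_add' := fun ξ η => by
        ext j
        change unitFun Λ l k (ξ + η) j = unitFun Λ l k ξ j + unitFun Λ l k η j
        by_cases h : Λ.restrict j = l <;> simp [unitFun, h]
      map_smul' := fun c ξ => by
        ext j; by_cases h : Λ.restrict j = l <;> simp [unitFun, h] } 1
    fun ξ => by
      rw [one_mul]
      exact lp.norm_le_of_forall_sum_le (by norm_num) (norm_nonneg _) (sum_unitFun_le Λ l k ξ)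

lemma matrixUnit_apply (Λ : Finset G) (l k : Λ → Fin d) (ξ : ConfigSpace G d) (j : Config G d) :
    matrixUnit Λ l k ξ j = if Λ.restrict j = l then ξ (overwrite Λ j k) else 0 := rfl

lemma matrixUnit_adjoint (Λ : Finset G) (l k : Λ → Fin d) :
    star (matrixUnit Λ l k) = matrixUnit Λ k l := by
  rw [ContinuousLinearMap.star_eq_adjoint, eq_comm, ContinuousLinearMap.eq_adjoint_iff]
  intro ξ η
  rw [lp.inner_eq_tsum, lp.inner_eq_tsum]
  refine tsum_eq_tsum_of_ne_zero_bij (fun i => overwrite Λ i.1 k) ?_ ?_ ?_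
  · rintro ⟨i, hi⟩ ⟨j, hj⟩ hij
    have key : ∀ i : Config G d, inner ℂ (ξ i) (matrixUnit Λ l k η i) ≠ 0 →
        Λ.restrict i = l := by
      intro i hi
      by_contra h
      exact hi (by simp [matrixUnit_apply, h])
    have h := congrArg (fun c => overwrite Λ c l) hij
    simpa [overwrite_of_restrict_eq (key i hi), overwrite_of_restrict_eq (key j hj)] using h
  · intro j hj
    have hk : Λ.restrict j = k := by
      by_contra h
      exact hj (by simp [matrixUnit_apply, h])
    refine ⟨⟨overwrite Λ j l, ?_⟩, ?_⟩
    · simpa [matrixUnit_apply, hk, overwrite_of_restrict_eq hk] using hj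
    · simp [overwrite_of_restrict_eq hk]
  · rintro ⟨i, hi⟩
    have hl : Λ.restrict i = l := by
      by_contra h
      exact hi (by simp [matrixUnit_apply, h])
    simp [matrixUnit_apply, hl, overwrite_of_restrict_eq hl]

/-- The operator on the configuration space given by `a ∈ S_Λ` acting on the sites in `Λ`. -/
def localOp (Λ : Finset G) (a : LocalMatrix d Λ) : ConfigSpace G d →L[ℂ] ConfigSpace G d :=
  ∑ l, ∑ k, a l k • matrixUnit Λ l k

lemma localOp_apply (Λ : Finset G) (a : LocalMatrix d Λ) (ξ : ConfigSpace G d)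
    (j : Config G d) :
    localOp Λ a ξ j = ∑ k, a (Λ.restrict j) k * ξ (overwrite Λ j k) := by
  have h : ∀ T : ConfigSpace G d →L[ℂ] ConfigSpace G d,
      T ξ j = (lp.evalCLM ℂ (fun _ : Config G d => ℂ) 2 j) (T ξ) := fun _ => rfl
  rw [h]
  simp only [localOp, FunLike.coe_sum, Finset.sum_apply, smul_apply, map_sum,
    map_smul, ← h]
  simp [matrixUnit_apply]

/-- The representation of `S_Λ` on the configuration space. -/
def localRep (Λ : Finset G) :
    LocalMatrix d Λ →⋆ₐ[ℂ] (ConfigSpace G d →L[ℂ] ConfigSpace G d) where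
  toFun := localOp Λ
  map_one' := by
    ext ξ j
    simp [localOp_apply, Matrix.one_apply]
  map_mul' a b := by
    ext ξ j
    simp only [localOp_apply, Matrix.mul_apply, mul_apply_eq_comp,
      restrict_overwrite, overwrite_overwrite, Finset.sum_mul, Finset.mul_sum]
    rw [Finset.sum_comm]
    simp [mul_assoc]
  map_zero' := by
    ext ξ j
    simp [localOp_apply]
  map_add' a b := by
    ext ξ j
    simp [localOp_apply, add_mul, Finset.sum_add_distrib]
  commutes' c := by
    ext ξ j
    simp [localOp_apply, Algebra.algebraMap_eq_smul_one, Matrix.one_apply]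
  map_star' a := by
    simp only [localOp, star_sum, star_smul, matrixUnit_adjoint, Matrix.star_apply]
    rw [Finset.sum_comm]

end Embedding

variable (G : Type*) [DecidableEq G] (d : ℕ)

/-- The quasi-local algebra `S^{⊗ G}`: the norm closure of the local observables. -/
def quasiLocal : StarSubalgebra ℂ (ConfigSpace G d →L[ℂ] ConfigSpace G d) :=
  (⨆ Λ : Finset G, (localRep (d := d) Λ).range).topologicalClosure

/-- The quasi-local algebra `S^{⊗ G}` as a C⋆-algebra. -/
def QuasiLocal : Type _ := quasiLocal G d

def quasiLocalCStarAlgebra : CStarAlgebra (QuasiLocal G d) :=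
  StarSubalgebra.cstarAlgebra (quasiLocal G d)
    (h_closed := StarSubalgebra.isClosed_topologicalClosure _)

instance : CStarAlgebra (QuasiLocal G d) := quasiLocalCStarAlgebra G d

/-- The standard order of a C⋆-algebra. -/
instance : PartialOrder (QuasiLocal G d) := CStarAlgebra.spectralOrder _

instance : StarOrderedRing (QuasiLocal G d) := CStarAlgebra.spectralOrderedRing _

variable {G d}

/-- The canonical embedding `S_Λ → S^{⊗ G}`. -/
def localEmbedding (Λ : Finset G) : LocalMatrix d Λ →⋆ₐ[ℂ] QuasiLocal G d :=
  (localRep Λ).codRestrict (quasiLocal G d) fun a =>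
    StarSubalgebra.le_topologicalClosure _
      (le_iSup (fun Λ : Finset G => (localRep (d := d) Λ).range) Λ ⟨a, rfl⟩)

lemma localEmbedding_injective [NeZero d] (Λ : Finset G) :
    Function.Injective (localEmbedding (d := d) Λ) := by
  classical
  intro a b hab
  ext l k
  have h : localOp Λ a = localOp Λ b := congrArg Subtype.val hab
  let j : Config G d := overwrite Λ (fun _ => 0) l
  have h1 := congrArg (fun T : ConfigSpace G d →L[ℂ] ConfigSpace G d =>
    T (lp.single 2 (overwrite Λ (fun _ => 0) k) (1 : ℂ)) j) h
  have hinj : ∀ m : Λ → Fin d,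
      (overwrite Λ (fun _ => 0) m : Config G d) = overwrite Λ (fun _ => 0) k ↔ m = k := by
    intro m
    refine ⟨fun hm => ?_, fun hm => by rw [hm]⟩
    simpa using congrArg Λ.restrict hm
  simpa [localOp_apply, j, lp.single_apply, Pi.single_apply, hinj] using h1

/-- `S_Λ` as a subalgebra of `S^{⊗ G}`. -/
def localAlgebra (d : ℕ) (Λ : Finset G) : StarSubalgebra ℂ (QuasiLocal G d) :=
  (localEmbedding Λ).range

/-- The identification of `S_Λ ⊆ S^{⊗ G}` with a matrix algebra (junk off `S_Λ`). -/
def toMatrix (Λ : Finset G) (a : QuasiLocal G d) : LocalMatrix d Λ :=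
  Function.invFun (localEmbedding Λ) a

lemma toMatrix_localEmbedding [NeZero d] (Λ : Finset G) (a : LocalMatrix d Λ) :
    toMatrix Λ (localEmbedding Λ a) = a :=
  Function.leftInverse_invFun (localEmbedding_injective Λ) a

/-! ### Frustration-free systems -/

/-- A frustration-free system of projections `p_Λ ∈ S_Λ`. -/
structure IsFrustrationFree (p : Finset G → QuasiLocal G d) : Prop where
  isStarProjection : ∀ Λ, IsStarProjection (p Λ)
  mem_local : ∀ Λ, p Λ ∈ localAlgebra d Λ
  mul_eq : ∀ Λ₁ Λ₂, Λ₁ ⊆ Λ₂ → p Λ₁ * p Λ₂ = p Λ₁ ∧ p Λ₂ * p Λ₁ = p Λ₁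

/-- The system is proper. -/
def IsProper (p : Finset G → QuasiLocal G d) : Prop := ∀ Λ, p Λ < 1

/-- `ω_Λ(a) = Tr(a p_Λ^⊥) / dim p_Λ^⊥` for `a ∈ S_Λ`. -/
def groundTrace (p : Finset G → QuasiLocal G d) (Λ : Finset G) (a : QuasiLocal G d) : ℂ :=
  (toMatrix Λ (a * (1 - p Λ))).trace / ((toMatrix Λ (1 - p Λ)).rank : ℂ)

/-- Local topological quantum order.  In the limit `Λ` eventually contains `Δ`, so that
`a ∈ S_Λ` and `groundTrace p Λ a` has its intended meaning. -/
def LTQO (p : Finset G → QuasiLocal G d) : Prop :=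
  ∀ Δ : Finset G, ∀ a ∈ localAlgebra d Δ,
    Tendsto (fun Λ : Finset G =>
      ‖(1 - p Λ) * a * (1 - p Λ) - groundTrace p Λ a • (1 - p Λ)‖) atTop (𝓝 0)

/-- A state of a unital C⋆-algebra. -/
def IsState {A : Type*} [CStarAlgebra A] [PartialOrder A] (ω : A →ₚ[ℂ] ℂ) : Prop := ω 1 = 1

/-- `ω` is a frustration-free ground state of the system `p`. -/
def IsGroundState (p : Finset G → QuasiLocal G d) (ω : QuasiLocal G d →ₚ[ℂ] ℂ) : Prop :=
  IsState ω ∧ ∀ Λ, ω (p Λ) = 0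

/-! ### Hereditary subalgebras -/

/-- Hereditary C⋆-subalgebras of a C⋆-algebra. -/
structure IsHereditary {A : Type*} [CStarAlgebra A] [PartialOrder A]
    (B : NonUnitalStarSubalgebra ℂ A) : Prop where
  isClosed : IsClosed (B : Set A)
  mem_of_le : ∀ a b : A, 0 ≤ a → a ≤ b → b ∈ B → a ∈ B

/-- Maximal elements of the poset of proper hereditary C⋆-subalgebras. -/
def IsMaximalHereditary {A : Type*} [CStarAlgebra A] [PartialOrder A]
    (B : NonUnitalStarSubalgebra ℂ A) : Prop :=
  Maximal (fun C : NonUnitalStarSubalgebra ℂ A => IsHereditary C ∧ C ≠ ⊤) B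

/-- For self-adjoint `w`, the C⋆-subalgebra `closure (w A w)`. -/
def corner {A : Type*} [CStarAlgebra A] (w : A) (hw : IsSelfAdjoint w) :
    NonUnitalStarSubalgebra ℂ A :=
  NonUnitalStarSubalgebra.topologicalClosure
    { carrier := Set.range fun a => w * a * w
      zero_mem' := ⟨0, by simp⟩
      add_mem' := by
        rintro _ _ ⟨a, rfl⟩ ⟨b, rfl⟩
        exact ⟨a + b, by simp [mul_add, add_mul]⟩
      mul_mem' := by
        rintro _ _ ⟨a, rfl⟩ ⟨b, rfl⟩
        exact ⟨a * w * (w * b), by simp [mul_assoc]⟩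
      smul_mem' := by
        rintro c _ ⟨a, rfl⟩
        exact ⟨c • a, by simp⟩
      star_mem' := by
        rintro _ ⟨a, rfl⟩
        exact ⟨star a, by simp [hw.star_eq, mul_assoc]⟩ }

/-- An increasing sequence of finite sets with union `G`. -/
def IsExhaustion (L : ℕ → Finset G) : Prop := Monotone L ∧ ∀ g, ∃ m, g ∈ L m

/-- `w = ∑_{m ≥ 1} 2^{-m} p_{Λ_m}`, with the sequence indexed from `0`. -/
def weight (p : Finset G → QuasiLocal G d) (L : ℕ → Finset G) : QuasiLocal G d :=
  ∑' m : ℕ, ((1 / 2 : ℂ) ^ (m + 1)) • p (L m)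

lemma isSelfAdjoint_weight {p : Finset G → QuasiLocal G d} (hp : IsFrustrationFree p)
    (L : ℕ → Finset G) : IsSelfAdjoint (weight p L) := by
  rw [isSelfAdjoint_iff, weight, tsum_star]
  refine tsum_congr fun m => ?_
  rw [star_smul, (hp.isStarProjection (L m)).isSelfAdjoint.star_eq]
  simp

/-- The hereditary subalgebra `𝔭⁻¹({p_Λ}) = closure (w S^{⊗ G} w)`, for the weight `w` formed along
the exhaustion `L`. -/
def hereditaryOf {p : Finset G → QuasiLocal G d} (hp : IsFrustrationFree p) (L : ℕ → Finset G) :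
    NonUnitalStarSubalgebra ℂ (QuasiLocal G d) :=
  corner (weight p L) (isSelfAdjoint_weight hp L)

end FrustrationFree

end

/-! Put `q Λ = 1 - p Λ`, a decreasing family of nonzero projections. Compressing further by a
smaller projection never spoils an approximation of `q a q` by a multiple of `q`. So the LTQO
hypothesis, given on local observables, extends by density to every `a`: there is a scalar `c(a)`
with `q a q - c(a) q → 0` (`exists_hasScalarLimit_of_dense`).

The map `a ↦ c(a)` is a state killing every `p Λ`. Any ground state `φ` satisfies `φ(a) = φ(q a q)`,
and the right side tends to `c(a)`, so it is the only one.

Along an exhaustion, the corner of the weight is `N ∩ N*`, where `N` is the closed left ideal `{x |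
x q → 0}` (`mem_corner_iff`). Let `C` be a proper hereditary subalgebra containing it, and let `x ∈
C`. If `c(x* x) ≠ 0`, then `p + c(x* x)⁻¹ q x* x q` lies in `C` and tends to `1`, which forces `C =
⊤`. Hence `c(x* x) = 0`, that is `‖x q‖² → 0`; the same applies to `x*`, so `C` is contained in the
corner. -/

noncomputable section

namespace FrustrationFree

/-! ### Scalar limits of compressions by decreasing projections -/

section Projections

variable {A : Type*} [CStarAlgebra A]

lemma norm_starProjection_eq_one {e : A} (he : IsStarProjection e) (h0 : e ≠ 0) : ‖e‖ = 1 := by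
  have h : ‖e‖ * ‖e‖ = ‖e‖ := by
    rw [← CStarRing.norm_star_mul_self, he.isSelfAdjoint.star_eq, he.isIdempotentElem.eq]
  exact mul_right_cancel₀ (norm_ne_zero_iff.mpr h0) (by rw [h, one_mul])

/-- A decreasing family of nonzero projections. -/
structure IsDecreasingProj {ι : Type*} [Preorder ι] (q : ι → A) : Prop where
  isStarProjection : ∀ i, IsStarProjection (q i)
  mul_eq : ∀ i j, i ≤ j → q i * q j = q j
  ne_zero : ∀ i, q i ≠ 0

variable {ι : Type*} [Preorder ι] {q : ι → A}

namespace IsDecreasingProj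

lemma star_eq (hq : IsDecreasingProj q) (i : ι) : star (q i) = q i :=
  (hq.isStarProjection i).isSelfAdjoint.star_eq

lemma mul_self (hq : IsDecreasingProj q) (i : ι) : q i * q i = q i :=
  (hq.isStarProjection i).isIdempotentElem.eq

lemma mul_eq' (hq : IsDecreasingProj q) {i j : ι} (h : i ≤ j) : q j * q i = q j := by
  simpa [hq.star_eq] using congrArg star (hq.mul_eq i j h)

lemma norm_eq (hq : IsDecreasingProj q) (i : ι) : ‖q i‖ = 1 :=
  norm_starProjection_eq_one (hq.isStarProjection i) (hq.ne_zero i)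

lemma norm_compression_le (hq : IsDecreasingProj q) (i : ι) (a : A) : ‖q i * a * q i‖ ≤ ‖a‖ := by
  calc ‖q i * a * q i‖ ≤ ‖q i‖ * ‖a‖ * ‖q i‖ := norm_mul₃_le
    _ = ‖a‖ := by simp [hq.norm_eq]

/-- Compressing by a smaller projection improves the approximation of `a` by a scalar. -/
lemma norm_compression_sub_le (hq : IsDecreasingProj q) {i j : ι} (h : i ≤ j) (a : A) (c : ℂ) :
    ‖q j * a * q j - c • q j‖ ≤ ‖q i * a * q i - c • q i‖ := by
  have key : q j * a * q j - c • q j = q j * (q i * a * q i - c • q i) * q j := by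
    simp only [mul_sub, sub_mul, mul_smul_comm, smul_mul_assoc, hq.mul_eq' h, hq.mul_self]
    rw [← mul_assoc, ← mul_assoc, hq.mul_eq' h, mul_assoc _ (q i), hq.mul_eq i j h]
  rw [key]
  exact hq.norm_compression_le j _

/-- A nonzero projection has norm one, so `‖c - e‖` can be read off from `(c - e) • q i`. At `a = b`
this is the Cauchy estimate for approximating scalars; in the limit it gives their uniqueness. -/
lemma norm_scalar_sub_le (hq : IsDecreasingProj q) (i : ι) (a b : A) (c e : ℂ) :
    ‖c - e‖ ≤ ‖q i * a * q i - c • q i‖ + ‖q i * b * q i - e • q i‖ + ‖a - b‖ := by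
  calc ‖c - e‖ = ‖(c - e) • q i‖ := by simp [norm_smul, hq.norm_eq]
    _ = ‖-(q i * a * q i - c • q i) + (q i * b * q i - e • q i) + q i * (a - b) * q i‖ := by
        congr 1
        simp only [mul_sub, sub_mul, sub_smul]
        abel
    _ ≤ ‖q i * a * q i - c • q i‖ + ‖q i * b * q i - e • q i‖ + ‖a - b‖ := by
        refine (norm_add₃_le).trans ?_
        rw [norm_neg]
        gcongr
        exact hq.norm_compression_le i _

end IsDecreasingProj

/-- The compressions of `a` are asymptotically the scalar `c`. -/
def HasScalarLimit (q : ι → A) (a : A) (c : ℂ) : Prop :=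
  Tendsto (fun i => q i * a * q i - c • q i) atTop (𝓝 0)

namespace HasScalarLimit

variable {a b : A} {c e : ℂ}

lemma add (ha : HasScalarLimit q a c) (hb : HasScalarLimit q b e) :
    HasScalarLimit q (a + b) (c + e) := by
  have h := Tendsto.add ha hb
  rw [add_zero] at h
  refine h.congr fun i => ?_
  simp only [mul_add, add_mul, add_smul]
  abel

lemma smul (r : ℂ) (ha : HasScalarLimit q a c) : HasScalarLimit q (r • a) (r * c) := by
  have h := Tendsto.const_smul ha r
  rw [smul_zero] at h
  refine h.congr fun i => ?_
  simp [smul_sub, smul_smul]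

lemma conj (hq : IsDecreasingProj q) (ha : HasScalarLimit q a c) :
    HasScalarLimit q (star a) (star c) := by
  have h := Tendsto.star ha
  rw [star_zero] at h
  refine h.congr fun i => ?_
  simp [hq.star_eq, mul_assoc]

lemma norm_sub_le [IsDirectedOrder ι] [Nonempty ι] (hq : IsDecreasingProj q)
    (ha : HasScalarLimit q a c) (hb : HasScalarLimit q b e) : ‖c - e‖ ≤ ‖a - b‖ := by
  have h := (ha.norm.add hb.norm).add_const ‖a - b‖
  simp only [norm_zero, add_zero, zero_add] at h
  exact ge_of_tendsto' h fun i => hq.norm_scalar_sub_le i a b c e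

lemma unique [IsDirectedOrder ι] [Nonempty ι] (hq : IsDecreasingProj q)
    (ha : HasScalarLimit q a c) (hb : HasScalarLimit q a e) : c = e := by
  have h := ha.norm_sub_le hq hb
  rw [sub_self, norm_zero] at h
  exact sub_eq_zero.mp (norm_le_zero_iff.mp h)

/-- Uniqueness applied to `star a = a` makes `c` real. If `c = r < 0`, then `q a q - r q ≥ -r q ≥ 0`
has norm at least `-r`, so it cannot tend to zero. -/
lemma nonneg [PartialOrder A] [StarOrderedRing A] [IsDirectedOrder ι] [Nonempty ι]
    (hq : IsDecreasingProj q) (ha : HasScalarLimit q a c) (h0 : 0 ≤ a) : 0 ≤ c := by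
  have hs : c = star c := by
    refine ha.unique hq ?_
    simpa [h0.isSelfAdjoint.star_eq] using ha.conj hq
  obtain ⟨r, rfl⟩ : ∃ r : ℝ, (r : ℂ) = c := Complex.conj_eq_iff_real.mp hs.symm |>.imp fun _ => Eq.symm
  by_contra hr
  have hr : r < 0 := by simpa using hr
  have h := Tendsto.norm ha
  rw [norm_zero] at h
  have hle : -r ≤ 0 := by
    refine ge_of_tendsto' h fun i => ?_
    have hqi : 0 ≤ q i := (hq.isStarProjection i).nonneg
    have h1 : ‖(-r) • q i‖ ≤ ‖q i * a * q i - (r : ℂ) • q i‖ := by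
      refine CStarAlgebra.norm_le_norm_of_nonneg_of_le (smul_nonneg (by linarith) hqi) ?_
      have h2 : 0 ≤ q i * a * q i := by
        simpa [hq.star_eq] using star_left_conjugate_nonneg h0 (q i)
      rw [neg_smul, Complex.coe_smul, sub_eq_add_neg]
      exact le_add_of_nonneg_left h2
    rwa [norm_smul, hq.norm_eq, mul_one, Real.norm_of_nonneg (by linarith)] at h1
  linarith

end HasScalarLimit

/-- An element whose compressions come arbitrarily close to scalars has a scalar limit. -/
lemma exists_hasScalarLimit [IsDirectedOrder ι] [Nonempty ι] (hq : IsDecreasingProj q) {a : A}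
    (h : ∀ ε > 0, ∃ i, ∃ c : ℂ, ‖q i * a * q i - c • q i‖ < ε) :
    ∃ c, HasScalarLimit q a c := by
  have h' : ∀ n : ℕ, ∃ i, ∃ c : ℂ, ‖q i * a * q i - c • q i‖ < 1 / ((n : ℝ) + 1) :=
    fun n => h _ (by positivity)
  choose i c hc using h'
  -- Both approximations survive compression to a common later index, where they can be compared.
  have hdist : ∀ n m, ‖c n - c m‖ ≤ 1 / ((n : ℝ) + 1) + 1 / ((m : ℝ) + 1) := by
    intro n m
    obtain ⟨j, hn, hm⟩ := exists_ge_ge (i n) (i m)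
    have h1 := hq.norm_scalar_sub_le j a a (c n) (c m)
    have h2 := (hq.norm_compression_sub_le hn a (c n)).trans (hc n).le
    have h3 := (hq.norm_compression_sub_le hm a (c m)).trans (hc m).le
    rw [sub_self, norm_zero] at h1
    linarith
  have hcauchy : CauchySeq c := by
    refine cauchySeq_of_le_tendsto_0 (fun n : ℕ => 1 / ((n : ℝ) + 1) + 1 / ((n : ℝ) + 1)) ?_ ?_
    · intro n m N hn hm
      rw [dist_eq_norm]
      exact (hdist n m).trans
        (add_le_add (Nat.one_div_le_one_div hn) (Nat.one_div_le_one_div hm))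
    · simpa using (tendsto_one_div_add_atTop_nhds_zero_nat (𝕜 := ℝ)).add
        tendsto_one_div_add_atTop_nhds_zero_nat
  obtain ⟨l, hl⟩ := cauchySeq_tendsto_of_complete hcauchy
  refine ⟨l, ?_⟩
  rw [HasScalarLimit, Metric.tendsto_nhds]
  intro ε hε
  have h1 := (tendsto_one_div_add_atTop_nhds_zero_nat (𝕜 := ℝ)).eventually_lt_const (half_pos hε)
  obtain ⟨n, hn1, hn2⟩ := (h1.and (Metric.tendsto_nhds.mp hl _ (half_pos hε))).exists
  filter_upwards [eventually_ge_atTop (i n)] with j hj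
  rw [dist_zero_right]
  calc ‖q j * a * q j - l • q j‖
      = ‖(q j * a * q j - c n • q j) + (c n - l) • q j‖ := by
        rw [sub_smul]
        abel_nf
    _ ≤ ‖q j * a * q j - c n • q j‖ + ‖(c n - l) • q j‖ := norm_add_le _ _
    _ < ε / 2 + ε / 2 := by
        refine add_lt_add (((hq.norm_compression_sub_le hj a _).trans_lt (hc n)).trans hn1) ?_
        rwa [norm_smul, hq.norm_eq, mul_one, ← dist_eq_norm]
    _ = ε := add_halves ε

/-- If the elements of a dense set have scalar limits, then all elements have one. -/
lemma exists_hasScalarLimit_of_dense [IsDirectedOrder ι] [Nonempty ι] (hq : IsDecreasingProj q)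
    {S : Set A} (hS : Dense S)
    (h : ∀ a ∈ S, ∃ c : ι → ℂ, Tendsto (fun i => ‖q i * a * q i - c i • q i‖) atTop (𝓝 0))
    (a : A) : ∃ c, HasScalarLimit q a c := by
  refine exists_hasScalarLimit hq fun ε hε => ?_
  obtain ⟨b, hb, hab⟩ := Metric.dense_iff.mp hS a (ε / 2) (half_pos hε)
  obtain ⟨c, hc⟩ := h b hab
  obtain ⟨i, hi⟩ := (hc.eventually_lt_const (half_pos hε)).exists
  refine ⟨i, c i, ?_⟩
  rw [Metric.mem_ball, dist_eq_norm, norm_sub_rev] at hb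
  calc ‖q i * a * q i - c i • q i‖
      = ‖q i * (a - b) * q i + (q i * b * q i - c i • q i)‖ := by
        simp only [mul_sub, sub_mul]
        abel_nf
    _ ≤ ‖q i * (a - b) * q i‖ + ‖q i * b * q i - c i • q i‖ := norm_add_le _ _
    _ < ε / 2 + ε / 2 := add_lt_add ((hq.norm_compression_le i _).trans_lt hb) hi
    _ = ε := add_halves ε

end Projections

/-! ### Existence and uniqueness of the ground state -/

section GroundState

variable {A : Type*} [CStarAlgebra A] [PartialOrder A] [StarOrderedRing A]

/-- The Cauchy–Schwarz inequality for a positive functional vanishing on a projection. -/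
lemma map_mul_eq_zero_of_starProjection (f : A →ₚ[ℂ] ℂ) {e : A} (he : IsStarProjection e)
    (h0 : f e = 0) (a : A) : f (a * e) = 0 := by
  have hn : ‖f.toPreGNS e‖ = 0 := by
    rw [f.preGNS_norm_def, f.ofPreGNS_toPreGNS, he.isSelfAdjoint.star_eq, he.isIdempotentElem.eq, h0]
    simp
  have h := norm_inner_le_norm (𝕜 := ℂ) (f.toPreGNS (star a)) (f.toPreGNS e)
  rw [hn, mul_zero, f.preGNS_inner_def] at h
  simpa using h

/-- The difference `a - e a e` is a sum of terms with a factor `1 - e` on the right or on the left,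
and Cauchy–Schwarz kills both kinds. -/
lemma map_compression_eq (f : A →ₚ[ℂ] ℂ) {e : A} (he : IsStarProjection e)
    (h0 : f (1 - e) = 0) (a : A) : f (e * a * e) = f a := by
  have h1 := map_mul_eq_zero_of_starProjection f he.one_sub h0
  have h2 : ∀ b, f ((1 - e) * b) = 0 := fun b => by
    rw [← star_star ((1 - e) * b), map_star, star_mul, he.one_sub.isSelfAdjoint.star_eq, h1, star_zero]
  have h3 : e * a * e = a - a * (1 - e) - (1 - e) * (a * e) := by noncomm_ring
  rw [h3, map_sub, map_sub, h1, h2, sub_zero, sub_zero]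

variable {ι : Type*} [Preorder ι] [IsDirectedOrder ι] [Nonempty ι] {q : ι → A}

theorem existsUnique_state_of_hasScalarLimit (hq : IsDecreasingProj q)
    (h : ∀ a, ∃ c, HasScalarLimit q a c) :
    ∃! ω : A →ₚ[ℂ] ℂ, IsState ω ∧ ∀ i, ω (1 - q i) = 0 := by
  choose c hc using h
  let ω : A →ₚ[ℂ] ℂ := PositiveLinearMap.mk₀
    { toFun := c
      map_add' := fun a b => (hc _).unique hq ((hc a).add (hc b))
      map_smul' := fun r a => (hc _).unique hq ((hc a).smul r) }
    fun a ha => (hc a).nonneg hq ha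
  refine ⟨ω, ⟨?_, fun i => ?_⟩, ?_⟩
  · refine (hc 1).unique hq ?_
    simp [HasScalarLimit, hq.mul_self]
  · refine (hc _).unique hq ?_
    refine tendsto_const_nhds.congr' ?_
    filter_upwards [eventually_ge_atTop i] with j hj
    simp [mul_sub, hq.mul_eq' hj]
  · rintro φ ⟨h1, h0⟩
    ext a
    have ht : Tendsto (fun i => φ (q i * a * q i - c a • q i)) atTop (𝓝 0) := by
      have := ((map_continuous φ).tendsto 0).comp (hc a)
      rwa [map_zero] at this
    -- The state does not see the compression, so the sequence tending to zero is constant.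
    have hconst : ∀ i, φ (q i * a * q i - c a • q i) = φ a - c a := fun i => by
      have hqi : φ (q i) = 1 := by
        have := h0 i
        rw [map_sub, h1, sub_eq_zero] at this
        exact this.symm
      rw [map_sub, map_compression_eq φ (hq.isStarProjection i) (h0 i), map_smul, hqi]
      simp
    simp only [hconst] at ht
    exact sub_eq_zero.mp (tendsto_const_nhds_iff.mp ht)

end GroundState

/-! ### The closed left ideal attached to the projections -/

section Hereditary

variable {A : Type*} [CStarAlgebra A]

/-- The left ideal of the elements `x` with `‖x q_i‖ → 0`. -/
def vanishingIdeal {ι : Type*} [Preorder ι] (q : ι → A) : Submodule ℂ A where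
  carrier := {x | Tendsto (fun i => x * q i) atTop (𝓝 0)}
  zero_mem' := by simpa using tendsto_const_nhds
  add_mem' {a b} ha hb := by
    simpa [add_mul] using Tendsto.add ha hb
  smul_mem' c a ha := by
    simpa using Tendsto.const_smul ha c

variable {ι : Type*} [Preorder ι] {q : ι → A}

lemma mem_vanishingIdeal {x : A} :
    x ∈ vanishingIdeal q ↔ Tendsto (fun i => x * q i) atTop (𝓝 0) := Iff.rfl

lemma isClosed_vanishingIdeal (hq : IsDecreasingProj q) :
    IsClosed (vanishingIdeal q : Set A) := by
  refine isClosed_of_closure_subset fun x hx => ?_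
  rw [SetLike.mem_coe, mem_vanishingIdeal, Metric.tendsto_nhds]
  intro ε hε
  obtain ⟨y, hy, hxy⟩ := Metric.mem_closure_iff.mp hx _ (half_pos hε)
  filter_upwards [Metric.tendsto_nhds.mp (mem_vanishingIdeal.mp hy) _ (half_pos hε)] with i hi
  rw [dist_zero_right] at hi ⊢
  rw [dist_eq_norm] at hxy
  calc ‖x * q i‖ = ‖(x - y) * q i + y * q i‖ := by rw [← add_mul, sub_add_cancel]
    _ ≤ ‖x - y‖ * ‖q i‖ + ‖y * q i‖ := (norm_add_le _ _).trans (by gcongr; exact norm_mul_le _ _)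
    _ < ε / 2 + ε / 2 := by
        rw [hq.norm_eq, mul_one]
        exact add_lt_add hxy hi
    _ = ε := add_halves ε

lemma mul_mem_vanishingIdeal (a : A) {x : A} (hx : x ∈ vanishingIdeal q) :
    a * x ∈ vanishingIdeal q := by
  simpa [mem_vanishingIdeal, mul_assoc] using Tendsto.const_mul a (mem_vanishingIdeal.mp hx)

lemma one_notMem_vanishingIdeal [IsDirectedOrder ι] [Nonempty ι] (hq : IsDecreasingProj q) :
    (1 : A) ∉ vanishingIdeal q := fun h => by
  have h := (mem_vanishingIdeal.mp h).norm
  simp [hq.norm_eq] at h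

/-- If `star x * x` has scalar limit zero, then `x` lies in the left ideal. -/
lemma mem_vanishingIdeal_of_hasScalarLimit_zero (hq : IsDecreasingProj q) {x : A}
    (h : HasScalarLimit q (star x * x) 0) : x ∈ vanishingIdeal q := by
  rw [mem_vanishingIdeal, tendsto_zero_iff_norm_tendsto_zero]
  have h := (Tendsto.norm h).sqrt
  simp only [zero_smul, sub_zero, norm_zero, Real.sqrt_zero] at h
  refine h.congr fun i => ?_
  rw [show q i * (star x * x) * q i = star (x * q i) * (x * q i) by
    simp [hq.star_eq, mul_assoc], CStarRing.norm_star_mul_self, Real.sqrt_mul_self (norm_nonneg _)]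

/-- Order controls only two-sided compressions, so the argument passes through `s = √a`: `‖s q‖² =
‖q a q‖ ≤ ‖q b q‖ ≤ ‖b q‖`. Then `a = s * s` lies in the left ideal. -/
lemma mem_vanishingIdeal_of_le [PartialOrder A] [StarOrderedRing A] (hq : IsDecreasingProj q)
    {a b : A} (ha : 0 ≤ a) (hab : a ≤ b) (hb : b ∈ vanishingIdeal q) : a ∈ vanishingIdeal q := by
  set s := CFC.sqrt a with hs
  have hss : s * s = a := CFC.sqrt_mul_sqrt_self a ha
  have hsa : star s = s := (CFC.sqrt_nonneg a).isSelfAdjoint.star_eq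
  have hlim : s ∈ vanishingIdeal q := by
    refine mem_vanishingIdeal_of_hasScalarLimit_zero hq ?_
    rw [hsa, hss]
    refine squeeze_zero_norm (fun i => ?_) (tendsto_zero_iff_norm_tendsto_zero.mp (mem_vanishingIdeal.mp hb))
    have h0 : 0 ≤ q i * a * q i := by
      simpa [hq.star_eq] using star_left_conjugate_nonneg ha (q i)
    have h1 : q i * a * q i ≤ q i * b * q i := by
      simpa [hq.star_eq] using star_left_conjugate_le_conjugate hab (q i)
    rw [zero_smul, sub_zero]
    calc ‖q i * a * q i‖ ≤ ‖q i * b * q i‖ := CStarAlgebra.norm_le_norm_of_nonneg_of_le h0 h1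
      _ ≤ ‖q i‖ * ‖b * q i‖ := by rw [mul_assoc]; exact norm_mul_le _ _
      _ = ‖b * q i‖ := by rw [hq.norm_eq, one_mul]
  rw [← hss]
  exact mul_mem_vanishingIdeal s hlim

end Hereditary

/-! ### The corner of the weight and its maximality -/

section Corner

variable {A : Type*} [CStarAlgebra A] {P : ℕ → A}

lemma summable_weight (hP : ∀ n, IsStarProjection (P n)) :
    Summable fun n => ((1 / 2 : ℂ) ^ (n + 1)) • P n := by
  refine Summable.of_norm_bounded (g := fun n => (1 / 2 : ℝ) ^ (n + 1))
    ((summable_nat_add_iff 1).mpr summable_geometric_two) fun n => ?_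
  rw [norm_smul]
  calc _ ≤ ‖(1 / 2 : ℂ) ^ (n + 1)‖ * 1 := by gcongr; exact (hP n).norm_le
    _ = _ := by simp

/-- An element that the first `m` projections annihilate and the later ones fix is an eigenvector
of the weight. -/
lemma weight_mul_eq (hP : ∀ n, IsStarProjection (P n)) {e : A} {m : ℕ}
    (h0 : ∀ n < m, P n * e = 0) (h1 : ∀ n, m ≤ n → P n * e = e) :
    (∑' n, ((1 / 2 : ℂ) ^ (n + 1)) • P n) * e = ((1 / 2 : ℂ) ^ m) • e := by
  rw [← (summable_weight hP).tsum_mul_right,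
    ← ((summable_weight hP).mul_right e).sum_add_tsum_nat_add m]
  have hz : ∑ n ∈ Finset.range m, ((1 / 2 : ℂ) ^ (n + 1)) • P n * e = 0 :=
    Finset.sum_eq_zero fun n hn => by
      rw [smul_mul_assoc, h0 n (Finset.mem_range.mp hn), smul_zero]
  -- The tail coefficients sum to `∑_{n ≥ m} 2^{-(n+1)} = 2^{-m}`.
  have hg : ∀ n, ((1 / 2 : ℂ) ^ (n + m + 1)) • P (n + m) * e
      = ((1 / 2 : ℂ) ^ n) • ((1 / 2 : ℂ) ^ (m + 1)) • e := fun n => by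
    rw [smul_mul_assoc, h1 _ (Nat.le_add_left m n), smul_smul, ← pow_add, add_assoc]
  have hn : ‖(1 / 2 : ℂ)‖ < 1 := by norm_num
  rw [hz, zero_add, tsum_congr hg, (summable_geometric_of_norm_lt_one hn).tsum_smul_const,
    tsum_geometric_of_norm_lt_one hn, smul_smul]
  congr 1
  rw [pow_succ]
  ring

/-- Each projection lies in the right ideal generated by the weight. -/
lemma exists_weight_mul_eq (hP : ∀ n, IsStarProjection (P n))
    (hmul : ∀ i j, i ≤ j → P i * P j = P i ∧ P j * P i = P i) (m : ℕ) :
    ∃ b, (∑' n, ((1 / 2 : ℂ) ^ (n + 1)) • P n) * b = P m := by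
  induction m with
  | zero =>
    refine ⟨P 0, ?_⟩
    rw [weight_mul_eq hP (m := 0) (by simp) fun n hn => (hmul 0 n hn).2]
    simp
  | succ m ih =>
    obtain ⟨b, hb⟩ := ih
    -- The increment `P (m + 1) - P m` is an eigenvector of the weight with eigenvalue `2^{-(m+1)}`;
    -- the factor inverts it.
    refine ⟨b + (2 : ℂ) ^ (m + 1) • (P (m + 1) - P m), ?_⟩
    rw [mul_add, hb, mul_smul_comm, weight_mul_eq hP (m := m + 1), smul_smul, ← mul_pow]
    · norm_num
    · intro n hn
      rw [mul_sub, (hmul n (m + 1) hn.le).1, (hmul n m (Nat.lt_succ_iff.mp hn)).1, sub_self]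
    · intro n hn
      rw [mul_sub, (hmul (m + 1) n hn).2, (hmul m n (by omega)).2]

lemma weight_mem_vanishingIdeal (hP : ∀ n, IsStarProjection (P n))
    (hmul : ∀ i j, i ≤ j → P i * P j = P i ∧ P j * P i = P i)
    (hq : IsDecreasingProj fun n => 1 - P n) :
    (∑' n, ((1 / 2 : ℂ) ^ (n + 1)) • P n) ∈ vanishingIdeal fun n => 1 - P n := by
  refine (isClosed_vanishingIdeal hq).mem_of_tendsto (summable_weight hP).hasSum
    (Eventually.of_forall fun s => Submodule.sum_mem _ fun n _ => Submodule.smul_mem _ _ ?_)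
  refine tendsto_const_nhds.congr' ?_
  filter_upwards [eventually_ge_atTop n] with j hj
  rw [mul_sub, mul_one, (hmul n j hj).1, sub_self]

/-- The weight is in the closed left ideal, which gives one inclusion. Conversely, `x q → 0` and `q
x → 0` give `P n * x * P n → x`, and these compressions lie in `w A w` because each `P n` is a
multiple of `w` from either side. -/
lemma mem_corner_iff (hP : ∀ n, IsStarProjection (P n))
    (hmul : ∀ i j, i ≤ j → P i * P j = P i ∧ P j * P i = P i)
    (hq : IsDecreasingProj fun n => 1 - P n)
    (hw : IsSelfAdjoint (∑' n, ((1 / 2 : ℂ) ^ (n + 1)) • P n)) {x : A} :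
    x ∈ corner _ hw ↔
      x ∈ vanishingIdeal (fun n => 1 - P n) ∧ star x ∈ vanishingIdeal (fun n => 1 - P n) := by
  set w := ∑' n, ((1 / 2 : ℂ) ^ (n + 1)) • P n
  have hwv : w ∈ vanishingIdeal fun n => 1 - P n := weight_mem_vanishingIdeal hP hmul hq
  have hcl : (corner w hw : Set A) = closure (Set.range fun a => w * a * w) := rfl
  rw [← SetLike.mem_coe, hcl]
  constructor
  · intro hx
    have hc := isClosed_vanishingIdeal hq
    refine closure_minimal ?_ (hc.inter (hc.preimage continuous_star)) hx
    rintro _ ⟨a, rfl⟩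
    refine ⟨mul_mem_vanishingIdeal _ hwv, ?_⟩
    rw [Set.mem_preimage, star_mul, star_mul, hw.star_eq, ← mul_assoc]
    exact mul_mem_vanishingIdeal _ hwv
  · rintro ⟨h1, h2⟩
    have h1 := mem_vanishingIdeal.mp h1
    have h2 := (mem_vanishingIdeal.mp h2).star
    have hbd : Tendsto (fun n => P n * (x * (1 - P n))) atTop (𝓝 0) := by
      refine squeeze_zero_norm (fun n => ?_) (by simpa using h1.norm)
      exact (norm_mul_le _ _).trans (mul_le_of_le_one_left (norm_nonneg _) (hP n).norm_le)
    have ht : Tendsto (fun n => P n * x * P n) atTop (𝓝 x) := by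
      have h := (tendsto_const_nhds (x := x)).sub (hbd.add h2)
      simp only [star_zero, add_zero, sub_zero] at h
      refine h.congr fun n => ?_
      rw [star_mul, star_star, hq.star_eq]
      noncomm_ring
    refine mem_closure_of_tendsto ht (Eventually.of_forall fun n => ?_)
    obtain ⟨b, hb⟩ := exists_weight_mul_eq hP hmul n
    have hb' : star b * w = P n := by
      have h := congrArg star hb
      rwa [star_mul, hw.star_eq, (hP n).isSelfAdjoint.star_eq] at h
    refine ⟨b * x * star b, ?_⟩
    calc w * (b * x * star b) * w = (w * b) * x * (star b * w) := by noncomm_ring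
      _ = P n * x * P n := by rw [hb, hb']

variable [PartialOrder A] [StarOrderedRing A]

theorem isMaximalHereditary_corner (hP : ∀ n, IsStarProjection (P n))
    (hmul : ∀ i j, i ≤ j → P i * P j = P i ∧ P j * P i = P i)
    (hq : IsDecreasingProj fun n => 1 - P n)
    (hw : IsSelfAdjoint (∑' n, ((1 / 2 : ℂ) ^ (n + 1)) • P n))
    (hlim : ∀ a, ∃ c, HasScalarLimit (fun n => 1 - P n) a c) :
    IsMaximalHereditary (corner _ hw) := by
  refine ⟨⟨⟨NonUnitalStarSubalgebra.isClosed_topologicalClosure _, ?_⟩, ?_⟩, ?_⟩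
  · intro a b ha hab hb
    have hav := mem_vanishingIdeal_of_le hq ha hab ((mem_corner_iff hP hmul hq hw).mp hb).1
    exact (mem_corner_iff hP hmul hq hw).mpr ⟨hav, by rwa [ha.isSelfAdjoint.star_eq]⟩
  · intro h
    have h1 : (1 : A) ∈ corner _ hw := h ▸ NonUnitalStarAlgebra.mem_top
    exact one_notMem_vanishingIdeal hq ((mem_corner_iff hP hmul hq hw).mp h1).1
  · rintro C ⟨hC, hne⟩ hle
    have hPC : ∀ n, P n ∈ C := fun n => hle <| (mem_corner_iff hP hmul hq hw).mpr <| by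
      have h : P n ∈ vanishingIdeal fun n => 1 - P n := by
        refine tendsto_const_nhds.congr' ?_
        filter_upwards [eventually_ge_atTop n] with j hj
        rw [mul_sub, mul_one, (hmul n j hj).1, sub_self]
      exact ⟨h, by rwa [(hP n).isSelfAdjoint.star_eq]⟩
    -- Every positive `a` is below `‖a‖ • 1`, and positive elements span the algebra.
    have h1C : (1 : A) ∉ C := fun h1 => hne <| by
      have hspan : Submodule.span ℂ {a : A | 0 ≤ a} ≤ C.toSubmodule :=
        Submodule.span_le.mpr fun a ha => hC.mem_of_le a _ ha
          (IsSelfAdjoint.le_algebraMap_norm_self (IsSelfAdjoint.of_nonneg ha)) <| by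
            rw [Algebra.algebraMap_eq_smul_one, ← Complex.coe_smul]
            exact SMulMemClass.smul_mem _ h1
      rw [CStarAlgebra.span_nonneg] at hspan
      exact eq_top_iff.mpr fun a _ => hspan Submodule.mem_top
    have hv : ∀ x ∈ C, x ∈ vanishingIdeal fun n => 1 - P n := by
      intro x hx
      obtain ⟨c, hc⟩ := hlim (star x * x)
      refine mem_vanishingIdeal_of_hasScalarLimit_zero hq ?_
      rcases eq_or_ne c 0 with rfl | hc0
      · exact hc
      exfalso
      have hy : star x * x ∈ C := mul_mem (star_mem hx) hx
      set y := star x * x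
      -- Since `q y q` is asymptotically `c q`, rescaling recovers the missing part `q = 1 - P n` of
      -- the unit.
      have ht : Tendsto (fun n => P n + c⁻¹ • ((1 - P n) * y * (1 - P n))) atTop (𝓝 1) := by
        have h := (Tendsto.const_smul hc c⁻¹).const_add 1
        simp only [smul_zero, add_zero] at h
        refine h.congr fun n => ?_
        rw [smul_sub, smul_smul, inv_mul_cancel₀ hc0, one_smul]
        abel
      refine h1C (hC.isClosed.mem_of_tendsto ht (Eventually.of_forall fun n => ?_))
      refine add_mem (hPC n) (SMulMemClass.smul_mem _ ?_)
      -- Although `1 ∉ C`, the expansion involves only products of `y` and `P n`.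
      rw [show (1 - P n) * y * (1 - P n) = y - P n * y - y * P n + P n * y * P n by noncomm_ring]
      exact add_mem (sub_mem (sub_mem hy (mul_mem (hPC n) hy)) (mul_mem hy (hPC n)))
        (mul_mem (mul_mem (hPC n) hy) (hPC n))
    exact fun x hx => (mem_corner_iff hP hmul hq hw).mpr ⟨hv x hx, hv _ (star_mem hx)⟩

end Corner

/-! ### Density of local observables and the projections `1 - p Λ` -/

section QuasiLocal

variable {G : Type*} [DecidableEq G] {d : ℕ}

lemma localRep_range_mono {Λ Λ' : Finset G} (h : Λ ⊆ Λ') :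
    (localRep (d := d) Λ).range ≤ (localRep (d := d) Λ').range := by
  rintro _ ⟨a, rfl⟩
  let ext (l : Λ' → Fin d) (m : Λ → Fin d) : Λ' → Fin d :=
    fun g => if hg : g.1 ∈ Λ then m ⟨g, hg⟩ else l g
  -- This is the matrix of `a ⊗ 1`: it acts on the sites of `Λ` and fixes the spins on `Λ' \ Λ`.
  let a' : LocalMatrix d Λ' := fun l k =>
    ∑ m, if k = ext l m then a (fun g => l ⟨g, h g.2⟩) m else 0
  refine ⟨a', ?_⟩
  change localOp Λ' a' = localOp Λ a
  ext ξ j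
  have hext : ∀ m, overwrite Λ' j (ext (Λ'.restrict j) m) = overwrite Λ j m := by
    intro m
    funext g
    by_cases hg : g ∈ Λ
    · simp [overwrite, ext, hg, h hg]
    · by_cases hg' : g ∈ Λ' <;> simp [overwrite, ext, hg, hg']
  rw [localOp_apply, localOp_apply]
  simp only [a', Finset.sum_mul, ite_mul, zero_mul]
  rw [Finset.sum_comm]
  simp only [Finset.sum_ite_eq', Finset.mem_univ, if_true, hext]
  rfl

lemma dense_iUnion_localAlgebra :
    Dense (⋃ Λ : Finset G, (localAlgebra d Λ : Set (QuasiLocal G d))) := by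
  have hdir : Directed (· ≤ ·) fun Λ : Finset G => (localRep (d := d) Λ).range := fun Λ₁ Λ₂ =>
    ⟨Λ₁ ∪ Λ₂, localRep_range_mono Finset.subset_union_left,
      localRep_range_mono Finset.subset_union_right⟩
  intro x
  have hx : x.1 ∈ closure
      (⋃ Λ : Finset G, ((localRep (d := d) Λ).range : Set (ConfigSpace G d →L[ℂ] _))) := by
    rw [← StarSubalgebra.coe_iSup_of_directed hdir]
    exact x.2
  refine (Metric.mem_closure_iff.mpr fun ε hε => ?_)
  obtain ⟨y, hy, hxy⟩ := Metric.mem_closure_iff.mp hx ε hε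
  obtain ⟨Λ, a, rfl⟩ := Set.mem_iUnion.mp hy
  exact ⟨localEmbedding Λ a, Set.mem_iUnion.mpr ⟨Λ, a, rfl⟩, hxy⟩

variable {p : Finset G → QuasiLocal G d}

lemma IsFrustrationFree.isDecreasingProj (hp : IsFrustrationFree p) (hproper : IsProper p)
    {ι : Type*} [Preorder ι] {L : ι → Finset G} (hL : Monotone L) :
    IsDecreasingProj fun i => 1 - p (L i) where
  isStarProjection i := (hp.isStarProjection (L i)).one_sub
  mul_eq i j h := by
    rw [sub_mul, one_mul, mul_sub, mul_one, (hp.mul_eq _ _ (hL h)).1, sub_self, sub_zero]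
  ne_zero i h := (hproper (L i)).ne (sub_eq_zero.mp h).symm

end QuasiLocal

end FrustrationFree
end
theorem mainTheorem10 {G : Type*} [Group G] [Group.FG G] [DecidableEq G] (d : ℕ) [NeZero d]
    (p : Finset G → FrustrationFree.QuasiLocal G d)
    (hp : FrustrationFree.IsFrustrationFree p) (hproper : FrustrationFree.IsProper p)
    (hLTQO : FrustrationFree.LTQO p) :
    (∃! ω : FrustrationFree.QuasiLocal G d →ₚ[ℂ] ℂ, FrustrationFree.IsGroundState p ω) ∧
      ∀ L : ℕ → Finset G, FrustrationFree.IsExhaustion L →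
        FrustrationFree.IsMaximalHereditary (FrustrationFree.hereditaryOf hp L) := by
  have hq := hp.isDecreasingProj hproper monotone_id
  have hlim : ∀ a, ∃ c, FrustrationFree.HasScalarLimit (fun Λ => 1 - p Λ) a c := by
    refine FrustrationFree.exists_hasScalarLimit_of_dense hq
      FrustrationFree.dense_iUnion_localAlgebra fun a ha => ?_
    obtain ⟨Δ, hΔ⟩ := Set.mem_iUnion.mp ha
    exact ⟨fun Λ => FrustrationFree.groundTrace p Λ a, hLTQO Δ a hΔ⟩
  refine ⟨?_, fun L hL => ?_⟩
  · simpa [FrustrationFree.IsGroundState] using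
      FrustrationFree.existsUnique_state_of_hasScalarLimit hq hlim
  · refine FrustrationFree.isMaximalHereditary_corner (fun n => hp.isStarProjection (L n))
      (fun i j h => hp.mul_eq _ _ (hL.1 h)) (hp.isDecreasingProj hproper hL.1) _ fun a => ?_
    obtain ⟨c, hc⟩ := hlim a
    -- An exhaustion is cofinal among the finite sets, so the limit along the net restricts to the
    -- sequence.
    exact ⟨c, hc.comp (hL.1.tendsto_atTop_finset hL.2)⟩
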